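/- \textbf{Lemma.} Let $\sigma>0$, and let $T\colon L_2([-1,1])\to L_2([-1,1])$ be the integral operator $$T[\phi](x)=\int_{-1}^{1}e^{-\sigma^2(x-y)^2}\,\phi(y)\,dy$$ on the space of real-valued square-integrable functions on $[-1,1]$ with Lebesgue measure. Let $\lambda_1\ge\lambda_2\ge\cdots$ be the positive eigenvalues of $T$, in decreasing order and counted with multiplicity. Then, for every integer $k\ge 1$, $$\lambda_k<8\cdot\Big(\frac{2}{e}(k-1)\Big)^{-\frac{k-1}{2}}\sigma^{k-1},$$ where $0^0=1$ when $k=1$. -/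

import Mathlib

open MeasureTheory

/-- The Gaussian kernel `exp (-σ² (x - y)²)` in one dimension. -/
noncomputable def gaussianKernel (σ x y : ℝ) : ℝ :=
  Real.exp (-σ ^ 2 * (x - y) ^ 2)

/-- Lebesgue measure on the interval `[-1, 1]`. -/
noncomputable def lebesgueInterval : Measure ℝ :=
  volume.restrict (Set.Icc (-1 : ℝ) 1)

instance lebesgueInterval_isFiniteMeasure : IsFiniteMeasure lebesgueInterval := by
  unfold lebesgueInterval
  infer_instance

/-- The Hilbert space `L₂([-1, 1])` of real-valued square-integrable functions. -/
abbrev L2Interval : Type := Lp ℝ 2 lebesgueInterval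

theorem gaussianKernel_continuous (σ : ℝ) :
    Continuous (fun p : ℝ × ℝ => gaussianKernel σ p.1 p.2) := by
  unfold gaussianKernel
  fun_prop

theorem gaussianKernel_norm_le_one (σ x y : ℝ) : ‖gaussianKernel σ x y‖ ≤ 1 := by
  unfold gaussianKernel
  rw [Real.norm_eq_abs, abs_of_pos (Real.exp_pos _), Real.exp_le_one_iff]
  have h := mul_nonneg (sq_nonneg σ) (sq_nonneg (x - y))
  linarith

theorem L2Interval_integrable (φ : L2Interval) : Integrable φ lebesgueInterval :=
  (Lp.memLp φ).integrable one_le_two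

theorem gaussianKernel_mul_integrable (σ x : ℝ) (φ : L2Interval) :
    Integrable (fun y => gaussianKernel σ x y * φ y) lebesgueInterval := by
  refine (L2Interval_integrable φ).bdd_mul (c := 1) ?_ ?_
  · exact ((gaussianKernel_continuous σ).comp
      (Continuous.prodMk_right x)).aestronglyMeasurable
  · exact Filter.Eventually.of_forall fun y => gaussianKernel_norm_le_one σ x y

theorem gaussianIntegral_memLp (σ : ℝ) (φ : L2Interval) :
    MemLp (fun x => ∫ y, gaussianKernel σ x y * φ y ∂lebesgueInterval) 2
      lebesgueInterval := by
  refine MemLp.of_bound (C := ∫ y, ‖φ y‖ ∂lebesgueInterval) ?_ ?_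
  · have h : AEStronglyMeasurable
        (fun p : ℝ × ℝ => gaussianKernel σ p.1 p.2 * φ p.2)
        (lebesgueInterval.prod lebesgueInterval) :=
      (gaussianKernel_continuous σ).aestronglyMeasurable.mul
        (Lp.aestronglyMeasurable φ).comp_snd
    exact h.integral_prod_right'
  · refine Filter.Eventually.of_forall fun x => ?_
    refine norm_integral_le_of_norm_le (L2Interval_integrable φ).norm
      (Filter.Eventually.of_forall fun y => ?_)
    rw [norm_mul]
    exact mul_le_of_le_one_left (norm_nonneg _) (gaussianKernel_norm_le_one σ x y)

/-- The integral operator `T : L₂([-1, 1]) → L₂([-1, 1])`,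
`T[φ](x) = ∫_{-1}^{1} exp (-σ² (x - y)²) φ(y) dy`. -/
noncomputable def gaussianOperator (σ : ℝ) : L2Interval →ₗ[ℝ] L2Interval where
  toFun φ := (gaussianIntegral_memLp σ φ).toLp
    (fun x => ∫ y, gaussianKernel σ x y * φ y ∂lebesgueInterval)
  map_add' φ ψ := by
    rw [← MemLp.toLp_add]
    refine MemLp.toLp_congr _ _ (Filter.Eventually.of_forall fun x => ?_)
    simp only [Pi.add_apply]
    rw [← integral_add (gaussianKernel_mul_integrable σ x φ)
      (gaussianKernel_mul_integrable σ x ψ)]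
    refine integral_congr_ae ?_
    filter_upwards [Lp.coeFn_add φ ψ] with y hy
    rw [hy, Pi.add_apply, mul_add]
  map_smul' c φ := by
    rw [RingHom.id_apply, ← MemLp.toLp_const_smul]
    refine MemLp.toLp_congr _ _ (Filter.Eventually.of_forall fun x => ?_)
    simp only [Pi.smul_apply, smul_eq_mul]
    rw [← integral_const_mul]
    refine integral_congr_ae ?_
    filter_upwards [Lp.coeFn_smul c φ] with y hy
    rw [hy, Pi.smul_apply, smul_eq_mul, mul_left_comm]

/-- The `k`-th largest eigenvalue (`k = 1, 2, …`), counted with multiplicity, of a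
compact positive self-adjoint operator `T`: the largest `μ > 0` such that the
eigenspaces of `T` for eigenvalues `ν ≥ μ` have total dimension at least `k`.
As usual it is `0` if `T` has fewer than `k` positive eigenvalues. -/
noncomputable def orderedEigenvalue {V : Type*} [AddCommGroup V] [Module ℝ V]
    (T : Module.End ℝ V) (k : ℕ) : ℝ :=
  sSup {μ : ℝ | 0 < μ ∧
    (k : Cardinal) ≤ Module.rank ℝ ↥(⨆ ν ∈ Set.Ici μ, T.eigenspace ν)}

/-!
The proof plays a Courant–Fischer bound against polynomial interpolation. If every section
`gaussianKernel σ x` is within `ε` in `L₂` of the `n`-dimensional space of polynomials of degree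
`< n`, then `‖T φ‖ ≤ √2 ε ‖φ‖` for all `φ` orthogonal to that space, so `λ_{n+1} ≤ √2 ε`.

To find `ε`, interpolate the sections at the zeros of the Chebyshev polynomial `Tₙ`; the error is
at most `sup |f⁽ⁿ⁾| / n! · 2 / 2ⁿ`. As `exp (-t²)` is the characteristic function of the normal law
`N(0, 2)`, its `n`-th derivative is at most the `n`-th absolute moment `n! / Γ(n/2 + 1)` of that
law. Altogether `λ_{n+1} ≤ 4 (σ/2)ⁿ / Γ(n/2 + 1)`, and `Γ(m + 1) ≥ (m/e)ᵐ` with `m = n/2` gives the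
theorem.
-/

section Interpolation

open Polynomial Set

theorem exists_iteratedDeriv_eq_zero (n : ℕ) {f : ℝ → ℝ} (hf : ContDiff ℝ n f)
    {x : Fin (n + 1) → ℝ} (hx : StrictMono x) (hfx : ∀ i, f (x i) = 0) :
    ∃ ξ ∈ Icc (x 0) (x (Fin.last n)), iteratedDeriv n f ξ = 0 := by
  induction n generalizing f with
  | zero => exact ⟨x 0, by simp, by simpa using hfx 0⟩
  | succ n ih =>
    have rolle (i : Fin (n + 1)) : ∃ c ∈ Ioo (x i.castSucc) (x i.succ), deriv f c = 0 :=
      exists_deriv_eq_zero (hx i.castSucc_lt_succ) hf.continuous.continuousOn (by rw [hfx, hfx])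
    choose c hc hfc using rolle
    have hc_mono : StrictMono c := fun i j hij ↦
      ((hc i).2.trans_le (hx.monotone (Fin.succ_le_castSucc_iff.mpr hij))).trans (hc j).1
    have hf' : ContDiff ℝ n (deriv f) :=
      ((contDiff_succ_iff_deriv (n := (n : WithTop ℕ∞))).mp (by exact_mod_cast hf)).2.2
    obtain ⟨ξ, hξ, hfξ⟩ := ih hf' hc_mono hfc
    refine ⟨ξ, ⟨(hc 0).1.le.trans hξ.1, hξ.2.trans (hc (Fin.last n)).2.le⟩, ?_⟩
    rwa [iteratedDeriv_succ']

theorem iteratedDeriv_polynomial_eval {𝕜 : Type*} [NontriviallyNormedField 𝕜] (p : 𝕜[X]) (n : ℕ) :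
    iteratedDeriv n (fun x ↦ p.eval x) = fun x ↦ (derivative^[n] p).eval x := by
  induction n with
  | zero => simp
  | succ n ih =>
    ext x
    rw [iteratedDeriv_succ, ih, Function.iterate_succ_apply', Polynomial.deriv]

theorem iterate_derivative_eq_C_of_natDegree_le {R : Type*} [Semiring R] {p : R[X]} {n : ℕ}
    (hp : p.natDegree ≤ n) : derivative^[n] p = C (n.factorial * p.coeff n) := by
  have hdeg : (derivative^[n] p).natDegree = 0 := by
    have := natDegree_iterate_derivative p n
    omega
  rw [eq_C_of_natDegree_eq_zero hdeg, coeff_iterate_derivative]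
  simp [Nat.descFactorial_self]

theorem exists_iteratedDeriv_eq_factorial_mul_coeff {n : ℕ} {f : ℝ → ℝ} (hf : ContDiff ℝ n f)
    {p : ℝ[X]} (hp : p.natDegree ≤ n) {s : Finset ℝ} (hs : s.card = n + 1) {a b : ℝ}
    (hsab : ↑s ⊆ Icc a b) (hfp : ∀ x ∈ s, f x = p.eval x) :
    ∃ ξ ∈ Icc a b, iteratedDeriv n f ξ = n.factorial * p.coeff n := by
  have hp_smooth : ContDiff ℝ n fun x ↦ p.eval x := by
    simpa using p.contDiff_aeval (n : WithTop ℕ∞) (R := ℝ) (𝕜 := ℝ)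
  let x := s.orderEmbOfFin hs
  have hx (i) : x i ∈ s := s.orderEmbOfFin_mem hs i
  obtain ⟨ξ, hξ, hfξ⟩ := exists_iteratedDeriv_eq_zero n (hf.sub hp_smooth) x.strictMono
    fun i ↦ sub_eq_zero.mpr (hfp _ (hx i))
  refine ⟨ξ, ⟨(hsab (hx 0)).1.trans hξ.1, hξ.2.trans (hsab (hx _)).2⟩, ?_⟩
  rw [iteratedDeriv_fun_sub hf.contDiffAt hp_smooth.contDiffAt, iteratedDeriv_polynomial_eval,
    iterate_derivative_eq_C_of_natDegree_le hp] at hfξ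
  simpa only [eval_C, sub_eq_zero] using hfξ

theorem exists_sub_eval_interpolate_eq {f : ℝ → ℝ} {s : Finset ℝ} (hf : ContDiff ℝ s.card f)
    {a b y : ℝ} (hs : ↑s ⊆ Icc a b) (hy : y ∈ Icc a b) :
    ∃ ξ ∈ Icc a b, f y - (Lagrange.interpolate s id f).eval y =
      iteratedDeriv s.card f ξ / s.card.factorial * (Lagrange.nodal s id).eval y := by
  set P := Lagrange.interpolate s id f
  set W := Lagrange.nodal s (id : ℝ → ℝ)
  have hPs (i) (hi : i ∈ s) : P.eval i = f i :=
    Lagrange.eval_interpolate_at_node f Function.injective_id.injOn hi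
  have hWs (i) (hi : i ∈ s) : W.eval i = 0 :=
    Lagrange.eval_nodal_at_node (v := (id : ℝ → ℝ)) hi
  by_cases hys : y ∈ s
  · exact ⟨y, hy, by simp [hPs y hys, hWs y hys]⟩
  have hWy : W.eval y ≠ 0 := Lagrange.eval_nodal_not_at_node fun i hi h ↦ hys (h ▸ hi)
  let c := (f y - P.eval y) / W.eval y
  let Q := P + C c * W
  have hfQ (i) (hi : i ∈ insert y s) : f i = Q.eval i := by
    rcases Finset.mem_insert.mp hi with rfl | hi
    · simp [Q, c, div_mul_cancel₀ _ hWy]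
    · simp [Q, hPs i hi, hWs i hi]
  have hP : P.degree < s.card := Lagrange.degree_interpolate_lt f Function.injective_id.injOn
  have hW : W.natDegree = s.card := Lagrange.natDegree_nodal
  have hQ : Q.natDegree ≤ s.card := natDegree_add_le_of_degree_le
    (natDegree_le_of_degree_le hP.le) ((natDegree_C_mul_le c W).trans hW.le)
  have hQc : Q.coeff s.card = c := by
    have hW1 : W.coeff s.card = 1 := hW ▸ Lagrange.nodal_monic.coeff_natDegree
    simp [Q, coeff_eq_zero_of_degree_lt hP, hW1]
  have hsy : ↑(insert y s) ⊆ Icc a b := by simpa [insert_subset_iff] using ⟨hy, hs⟩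
  obtain ⟨ξ, hξ, hfξ⟩ := exists_iteratedDeriv_eq_factorial_mul_coeff hf hQ
    (Finset.card_insert_of_notMem hys) hsy hfQ
  refine ⟨ξ, hξ, ?_⟩
  rw [hfξ, hQc, mul_div_cancel_left₀ _ (by positivity), div_mul_cancel₀ _ hWy]

/-- The zeros of the `n`-th Chebyshev polynomial of the first kind, used as interpolation nodes. -/
noncomputable def chebyshevNodes (n : ℕ) : Finset ℝ :=
  (Finset.range n).image fun k : ℕ ↦ Real.cos ((2 * k + 1) * Real.pi / (2 * n))

theorem card_chebyshevNodes (n : ℕ) : (chebyshevNodes n).card = n := by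
  rw [chebyshevNodes, Finset.card_image_of_injOn, Finset.card_range]
  exact (Finset.range n).nodup_map_iff_injOn.mp (Chebyshev.roots_T_real_nodup n)

theorem chebyshevNodes_subset_Icc (n : ℕ) : ↑(chebyshevNodes n) ⊆ Icc (-1 : ℝ) 1 := by
  intro x hx
  obtain ⟨k, -, rfl⟩ := Finset.mem_image.mp (Finset.mem_coe.mp hx)
  exact Real.cos_mem_Icc _

theorem C_mul_nodal_chebyshevNodes (n : ℕ) :
    C (2 ^ (n - 1)) * Lagrange.nodal (chebyshevNodes n) id = Chebyshev.T ℝ n := by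
  have hroots : (Chebyshev.T ℝ n).roots = (chebyshevNodes n).val := Chebyshev.roots_T_real n
  have hcard : (Chebyshev.T ℝ n).roots.card = (Chebyshev.T ℝ n).natDegree := by
    rw [hroots, Finset.card_val, card_chebyshevNodes, Chebyshev.natDegree_T, Int.natAbs_natCast]
  simpa [hroots, Lagrange.nodal_eq] using C_leadingCoeff_mul_prod_multiset_X_sub_C hcard

theorem abs_eval_nodal_chebyshevNodes_le (n : ℕ) {y : ℝ} (hy : y ∈ Icc (-1 : ℝ) 1) :
    |(Lagrange.nodal (chebyshevNodes n) id).eval y| ≤ 2 / 2 ^ n := by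
  have hT : |2 ^ (n - 1) * (Lagrange.nodal (chebyshevNodes n) id).eval y| ≤ 1 := by
    simpa [← C_mul_nodal_chebyshevNodes] using
      Chebyshev.abs_eval_T_real_le_one n (abs_le.mpr hy)
  rw [abs_mul, abs_of_pos (by positivity)] at hT
  -- an inequality only because of `n = 0`, where `n - 1` is truncated
  have hpow : (2 : ℝ) ^ n ≤ 2 * 2 ^ (n - 1) := by
    rw [← pow_succ']
    exact pow_le_pow_right₀ one_le_two (by omega)
  rw [le_div_iff₀ (by positivity)]
  calc |(Lagrange.nodal (chebyshevNodes n) id).eval y| * 2 ^ n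
      ≤ |(Lagrange.nodal (chebyshevNodes n) id).eval y| * (2 * 2 ^ (n - 1)) := by gcongr
    _ ≤ 2 := by linarith

theorem exists_mem_degreeLT_abs_sub_eval_le {n : ℕ} {f : ℝ → ℝ} (hf : ContDiff ℝ n f) {M : ℝ}
    (hM : ∀ ξ ∈ Icc (-1 : ℝ) 1, |iteratedDeriv n f ξ| ≤ M) :
    ∃ p ∈ degreeLT ℝ n, ∀ y ∈ Icc (-1 : ℝ) 1,
      |f y - p.eval y| ≤ M / n.factorial * (2 / 2 ^ n) := by
  have hcard := card_chebyshevNodes n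
  refine ⟨Lagrange.interpolate (chebyshevNodes n) id f, ?_, fun y hy ↦ ?_⟩
  · rw [mem_degreeLT]
    exact (Lagrange.degree_interpolate_lt f Function.injective_id.injOn).trans_eq (by rw [hcard])
  · obtain ⟨ξ, hξ, herr⟩ := exists_sub_eval_interpolate_eq (by rwa [hcard])
      (chebyshevNodes_subset_Icc n) hy
    rw [herr, hcard, abs_mul, abs_div, Nat.abs_cast]
    have hM0 : 0 ≤ M := (abs_nonneg _).trans (hM ξ hξ)
    gcongr
    exacts [hM ξ hξ, abs_eval_nodal_chebyshevNodes_le n hy]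

end Interpolation

section GaussianDerivatives

open ProbabilityTheory Real Set

theorem norm_iteratedDeriv_charFun_le {μ : Measure ℝ} [IsFiniteMeasure μ] {n : ℕ}
    (hμ : MemLp id n μ) (t : ℝ) : ‖iteratedDeriv n (charFun μ) t‖ ≤ ∫ x, |x| ^ n ∂μ := by
  rw [iteratedDeriv_charFun hμ, norm_mul, norm_pow, Complex.norm_I, one_pow, one_mul]
  refine (norm_integral_le_integral_norm _).trans_eq (integral_congr_ae (.of_forall fun x ↦ ?_))
  simp [← Complex.ofReal_mul, Complex.norm_exp_ofReal_mul_I]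

theorem integral_abs_pow_mul_exp_neg_mul_sq {b : ℝ} (hb : 0 < b) (n : ℕ) :
    ∫ x : ℝ, |x| ^ n * exp (-b * x ^ 2) =
      b ^ (-((n : ℝ) + 1) / 2) * Gamma (((n : ℝ) + 1) / 2) := by
  have hn : (-1 : ℝ) < n := by linarith [n.cast_nonneg (α := ℝ)]
  have habs := integral_comp_abs (f := fun x : ℝ ↦ x ^ n * exp (-b * x ^ 2))
  have hGamma := integral_rpow_mul_exp_neg_mul_rpow two_pos hn hb
  simp only [sq_abs] at habs
  simp only [rpow_natCast, rpow_ofNat] at hGamma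
  rw [habs, hGamma]
  ring

theorem Gamma_mul_Gamma_mul_two_pow (n : ℕ) :
    Gamma (((n : ℝ) + 1) / 2) * Gamma ((n : ℝ) / 2 + 1) * 2 ^ n = n.factorial * √π := by
  have h := Gamma_mul_Gamma_add_half (((n : ℝ) + 1) / 2)
  rw [show ((n : ℝ) + 1) / 2 + 1 / 2 = n / 2 + 1 by ring,
    show 2 * (((n : ℝ) + 1) / 2) = n + 1 by ring, Gamma_nat_eq_factorial,
    show (1 : ℝ) - (n + 1) = -n by ring, rpow_neg two_pos.le, rpow_natCast] at h
  rw [h]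
  field_simp

theorem integral_abs_pow_gaussianReal_two (n : ℕ) :
    ∫ x, |x| ^ n ∂gaussianReal 0 2 = n.factorial / Gamma ((n : ℝ) / 2 + 1) := by
  have hGamma : 0 < Gamma ((n : ℝ) / 2 + 1) := Gamma_pos_of_pos (by positivity)
  have hpdf (x : ℝ) : gaussianPDFReal 0 2 x • |x| ^ n =
      (2 * √π)⁻¹ * (|x| ^ n * exp (-(1 / 4) * x ^ 2)) := by
    have hsqrt : √(2 * π * 2) = 2 * √π := by
      rw [show 2 * π * 2 = 2 ^ 2 * π by ring, sqrt_mul (by positivity), sqrt_sq two_pos.le]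
    rw [gaussianPDFReal, NNReal.coe_ofNat, hsqrt, smul_eq_mul,
      show -(x - 0) ^ 2 / (2 * 2) = -(1 / 4) * x ^ 2 by ring]
    ring
  have hpow : (1 / 4 : ℝ) ^ (-((n : ℝ) + 1) / 2) = 2 * 2 ^ n := by
    rw [show (1 / 4 : ℝ) = 2 ^ (-2 : ℝ) by norm_num [rpow_neg], ← rpow_mul two_pos.le,
      show -2 * (-((n : ℝ) + 1) / 2) = ((n + 1 : ℕ) : ℝ) by push_cast; ring, rpow_natCast,
      pow_succ']
  rw [integral_gaussianReal_eq_integral_smul two_ne_zero]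
  simp_rw [hpdf]
  rw [integral_const_mul, integral_abs_pow_mul_exp_neg_mul_sq (by norm_num), hpow,
    eq_div_iff hGamma.ne']
  have hdup := Gamma_mul_Gamma_mul_two_pow n
  generalize Gamma ((n : ℝ) / 2 + 1) = G at hdup ⊢
  field_simp
  linear_combination hdup

theorem abs_iteratedDeriv_exp_neg_sq_le (n : ℕ) (t : ℝ) :
    |iteratedDeriv n (fun t ↦ exp (-t ^ 2)) t| ≤ n.factorial / Gamma ((n : ℝ) / 2 + 1) := by
  have hsmooth : ContDiff ℝ n fun t : ℝ ↦ exp (-t ^ 2) := by fun_prop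
  have hchar : Complex.ofRealLI ∘ (fun t : ℝ ↦ exp (-t ^ 2)) = charFun (gaussianReal 0 2) := by
    ext t
    simp [charFun_gaussianReal]
  rw [← norm_eq_abs, ← norm_iteratedFDeriv_eq_norm_iteratedDeriv,
    ← Complex.ofRealLI.norm_iteratedFDeriv_comp_left hsmooth.contDiffAt le_rfl, hchar,
    norm_iteratedFDeriv_eq_norm_iteratedDeriv, ← integral_abs_pow_gaussianReal_two]
  exact norm_iteratedDeriv_charFun_le (memLp_id_gaussianReal' n (by simp)) t

theorem abs_iteratedDeriv_gaussianKernel_le (σ x : ℝ) (n : ℕ) (y : ℝ) :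
    |iteratedDeriv n (gaussianKernel σ x) y| ≤
      |σ| ^ n * (n.factorial / Gamma ((n : ℝ) / 2 + 1)) := by
  have hkernel : gaussianKernel σ x = fun y ↦ (fun z ↦ exp (-(σ * z) ^ 2)) (y - x) := by
    ext y
    rw [gaussianKernel, ← neg_sub y x]
    ring_nf
  have hderiv : iteratedDeriv n (fun z ↦ exp (-(σ * z) ^ 2)) =
      fun z ↦ σ ^ n * iteratedDeriv n (fun t ↦ exp (-t ^ 2)) (σ * z) :=
    iteratedDeriv_comp_const_mul (f := fun t ↦ exp (-t ^ 2)) (by fun_prop) σ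
  rw [hkernel, congrFun (iteratedDeriv_comp_sub_const n (fun z ↦ exp (-(σ * z) ^ 2)) x) y, hderiv,
    abs_mul, abs_pow]
  gcongr
  exact abs_iteratedDeriv_exp_neg_sq_le n _

end GaussianDerivatives

section CourantFischer

theorem exists_mem_orthogonal_ne_zero {𝕜 E : Type*} [RCLike 𝕜] [NormedAddCommGroup E]
    [InnerProductSpace 𝕜 E] {V W : Submodule 𝕜 E} [FiniteDimensional 𝕜 W]
    (h : (Module.finrank 𝕜 W : Cardinal) < Module.rank 𝕜 V) : ∃ v ∈ V, v ∈ Wᗮ ∧ v ≠ 0 := by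
  by_contra! hV
  let P : V →ₗ[𝕜] W := W.orthogonalProjectionOnto.toLinearMap.domRestrict V
  have hP : Function.Injective P := (injective_iff_map_eq_zero P).mpr fun v hv ↦
    Subtype.ext (hV v v.2 (Submodule.orthogonalProjectionOnto_eq_zero_iff.mp hv))
  rw [Module.finrank_eq_rank] at h
  exact (LinearMap.rank_le_of_injective P hP).not_gt h

variable {E : Type*} [NormedAddCommGroup E] [InnerProductSpace ℝ E] {T : E →ₗ[ℝ] E}

theorem mul_norm_sq_le_inner_of_mem_iSup_eigenspace (hT : T.IsSymmetric) {μ : ℝ} {v : E}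
    (hv : v ∈ ⨆ ν ∈ Set.Ici μ, Module.End.eigenspace T ν) :
    μ * ‖v‖ ^ 2 ≤ inner ℝ (T v) v := by
  classical
  rw [iSup_subtype', Submodule.mem_iSup_iff_exists_finsupp] at hv
  obtain ⟨w, hw, rfl⟩ := hv
  have horth : OrthogonalFamily ℝ (fun ν : Set.Ici μ ↦ Module.End.eigenspace T (ν : ℝ))
      fun ν ↦ (Module.End.eigenspace T (ν : ℝ)).subtypeₗᵢ :=
    hT.orthogonalFamily_eigenspaces.comp Subtype.coe_injective
  have hTw (ν) : T (w ν) = (ν : ℝ) • w ν := Module.End.mem_eigenspace_iff.mp (hw ν)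
  have hinner := horth.inner_sum (fun ν ↦ ⟨w ν, hw ν⟩) (fun ν ↦ ⟨w ν, hw ν⟩) w.support
  have hinnerT := horth.inner_sum (fun ν ↦ (ν : ℝ) • ⟨w ν, hw ν⟩) (fun ν ↦ ⟨w ν, hw ν⟩) w.support
  simp only [Submodule.coe_subtypeₗᵢ, Submodule.subtype_apply, Submodule.coe_smul,
    Submodule.coe_inner] at hinner hinnerT
  rw [← real_inner_self_eq_norm_sq, Finsupp.sum, map_sum]
  simp only [hTw]
  rw [hinner, hinnerT, Finset.mul_sum]
  refine Finset.sum_le_sum fun ν _ ↦ ?_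
  rw [real_inner_smul_left]
  exact mul_le_mul_of_nonneg_right ν.2 real_inner_self_nonneg

theorem orderedEigenvalue_le_of_forall_mem_orthogonal (hT : T.IsSymmetric) {W : Submodule ℝ E}
    [FiniteDimensional ℝ W] {k : ℕ} (hk : Module.finrank ℝ W < k) {B : ℝ} (hB : 0 ≤ B)
    (hTB : ∀ v ∈ Wᗮ, inner ℝ (T v) v ≤ B * ‖v‖ ^ 2) : orderedEigenvalue T k ≤ B := by
  refine Real.sSup_le ?_ hB
  rintro μ ⟨-, hμ⟩
  obtain ⟨v, hvV, hvW, hv0⟩ :=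
    exists_mem_orthogonal_ne_zero (W := W) ((Nat.cast_lt.mpr hk).trans_le hμ)
  have hμB : μ * ‖v‖ ^ 2 ≤ B * ‖v‖ ^ 2 :=
    (mul_norm_sq_le_inner_of_mem_iSup_eigenspace hT hvV).trans (hTB v hvW)
  exact le_of_mul_le_mul_right hμB (by positivity)

end CourantFischer

section IntegralOperator

variable {α : Type*} [MeasurableSpace α] {μ : Measure α} [IsFiniteMeasure μ]

theorem norm_le_sqrt_measureReal_univ_mul {E : Type*} [NormedAddCommGroup E] {f : Lp E 2 μ} {C : ℝ}
    (hC : 0 ≤ C) (hf : ∀ᵐ x ∂μ, ‖f x‖ ≤ C) : ‖f‖ ≤ √(μ.real Set.univ) * C := by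
  have hμ : (measureUnivNNReal μ : ℝ) = μ.real Set.univ := rfl
  simpa [Real.sqrt_eq_rpow, hμ] using Lp.norm_le_of_ae_bound hC hf

variable {T : Lp ℝ 2 μ →ₗ[ℝ] Lp ℝ 2 μ}

theorem isSymmetric_of_ae_eq_integral_mul {K : α → α → ℝ} {C : ℝ}
    (hK : AEStronglyMeasurable (Function.uncurry K) (μ.prod μ)) (hKC : ∀ x y, ‖K x y‖ ≤ C)
    (hK_comm : ∀ x y, K x y = K y x) (hTK : ∀ φ, T φ =ᵐ[μ] fun x ↦ ∫ y, K x y * φ y ∂μ) :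
    T.IsSymmetric := by
  have hinner (φ ψ : Lp ℝ 2 μ) : inner ℝ (T φ) ψ = ∫ x, ∫ y, K x y * (φ y * ψ x) ∂μ ∂μ := by
    rw [L2.inner_def]
    refine integral_congr_ae ?_
    filter_upwards [hTK φ] with x hx
    simp_rw [hx, ← mul_assoc, integral_mul_const, real_inner_eq_re_inner]
    simp [mul_comm]
  have hint (φ : Lp ℝ 2 μ) : Integrable φ μ := (Lp.memLp φ).integrable one_le_two
  intro φ ψ
  rw [← real_inner_comm φ, hinner, hinner, integral_integral_swap]
  · simp_rw [hK_comm, mul_comm]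
  · refine (((hint ψ).mul_prod (hint φ)).bdd_mul (c := C) hK (.of_forall fun p ↦ hKC p.1 p.2)).congr
      (.of_forall fun p ↦ ?_)
    simp only [Function.uncurry, mul_comm]

theorem orderedEigenvalue_le_of_ae_exists_mem_norm_sub_le (hT : T.IsSymmetric)
    {κ : α → Lp ℝ 2 μ} (hTκ : ∀ φ, T φ =ᵐ[μ] fun x ↦ inner ℝ (κ x) φ)
    {W : Submodule ℝ (Lp ℝ 2 μ)} [FiniteDimensional ℝ W] {k : ℕ} (hk : Module.finrank ℝ W < k)
    {ε : ℝ} (hε : 0 ≤ ε) (hκ : ∀ᵐ x ∂μ, ∃ p ∈ W, ‖κ x - p‖ ≤ ε) :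
    orderedEigenvalue T k ≤ √(μ.real Set.univ) * ε := by
  refine orderedEigenvalue_le_of_forall_mem_orthogonal hT hk (by positivity) fun φ hφ ↦ ?_
  have hpointwise : ∀ᵐ x ∂μ, ‖T φ x‖ ≤ ε * ‖φ‖ := by
    filter_upwards [hTκ φ, hκ] with x hx ⟨p, hpW, hp⟩
    have hpφ : inner ℝ p φ = 0 := Submodule.inner_right_of_mem_orthogonal hpW hφ
    rw [hx, ← sub_zero (inner ℝ (κ x) φ), ← hpφ, ← inner_sub_left]
    exact (norm_inner_le_norm _ _).trans (by gcongr)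
  have hnorm : ‖T φ‖ ≤ √(μ.real Set.univ) * (ε * ‖φ‖) :=
    norm_le_sqrt_measureReal_univ_mul (by positivity) hpointwise
  calc inner ℝ (T φ) φ ≤ ‖T φ‖ * ‖φ‖ := real_inner_le_norm _ _
    _ ≤ √(μ.real Set.univ) * (ε * ‖φ‖) * ‖φ‖ := by gcongr
    _ = √(μ.real Set.univ) * ε * ‖φ‖ ^ 2 := by ring

end IntegralOperator

section GaussianOperator

open Polynomial Real Set

theorem measureReal_lebesgueInterval_univ : lebesgueInterval.real univ = 2 := by
  norm_num [lebesgueInterval, Measure.real]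

theorem ae_mem_Icc_lebesgueInterval : ∀ᵐ y ∂lebesgueInterval, y ∈ Icc (-1 : ℝ) 1 :=
  ae_restrict_mem measurableSet_Icc

theorem memLp_lebesgueInterval_of_continuous {f : ℝ → ℝ} (hf : Continuous f) (p : ENNReal) :
    MemLp f p lebesgueInterval := by
  obtain ⟨C, hC⟩ := isCompact_Icc.exists_bound_of_continuousOn hf.continuousOn
  exact .of_bound hf.aestronglyMeasurable C (ae_mem_Icc_lebesgueInterval.mono hC)

/-- The class in `L₂([-1, 1])` of a continuous function on `ℝ`, so that polynomials and the
sections of the kernel can be compared inside one Hilbert space. -/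
noncomputable def continuousToL2Interval : C(ℝ, ℝ) →ₗ[ℝ] L2Interval where
  toFun f := (memLp_lebesgueInterval_of_continuous f.continuous 2).toLp f
  map_add' _ _ := rfl
  map_smul' _ _ := rfl

theorem coeFn_continuousToL2Interval (f : C(ℝ, ℝ)) :
    continuousToL2Interval f =ᵐ[lebesgueInterval] f :=
  (memLp_lebesgueInterval_of_continuous f.continuous 2).coeFn_toLp

theorem inner_continuousToL2Interval (f : C(ℝ, ℝ)) (φ : L2Interval) :
    inner ℝ (continuousToL2Interval f) φ = ∫ y, f y * φ y ∂lebesgueInterval := by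
  rw [L2.inner_def]
  refine integral_congr_ae ?_
  filter_upwards [coeFn_continuousToL2Interval f] with y hy
  simp [hy, mul_comm]

theorem norm_continuousToL2Interval_le {f : C(ℝ, ℝ)} {M : ℝ}
    (hf : ∀ y ∈ Icc (-1 : ℝ) 1, |f y| ≤ M) : ‖continuousToL2Interval f‖ ≤ √2 * M := by
  have hM : 0 ≤ M := (abs_nonneg _).trans (hf 0 (by norm_num))
  have hbound : ∀ᵐ y ∂lebesgueInterval, ‖continuousToL2Interval f y‖ ≤ M := by
    filter_upwards [coeFn_continuousToL2Interval f, ae_mem_Icc_lebesgueInterval] with y hfy hy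
    exact hfy ▸ hf y hy
  simpa [measureReal_lebesgueInterval_univ] using norm_le_sqrt_measureReal_univ_mul hM hbound

/-- The subspace of `L₂([-1, 1])` of polynomial functions of degree less than `n`. -/
noncomputable def polynomialsLT (n : ℕ) : Submodule ℝ L2Interval :=
  (degreeLT ℝ n).map (continuousToL2Interval ∘ₗ toContinuousMapAlgHom.toLinearMap)

instance (n : ℕ) : FiniteDimensional ℝ (polynomialsLT n) := by
  unfold polynomialsLT
  infer_instance

theorem finrank_polynomialsLT_le (n : ℕ) : Module.finrank ℝ (polynomialsLT n) ≤ n :=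
  (Submodule.finrank_map_le _ _).trans_eq <| by
    rw [Module.finrank_eq_card_basis (degreeLT.basis ℝ n), Fintype.card_fin]

theorem gaussianKernel_comm (σ x y : ℝ) : gaussianKernel σ x y = gaussianKernel σ y x := by
  rw [gaussianKernel, gaussianKernel, sub_sq_comm]

/-- The section `y ↦ gaussianKernel σ x y` of the kernel, as a continuous function. -/
noncomputable def gaussianSection (σ x : ℝ) : C(ℝ, ℝ) :=
  ⟨gaussianKernel σ x, (gaussianKernel_continuous σ).comp (.prodMk_right x)⟩

theorem coeFn_gaussianOperator (σ : ℝ) (φ : L2Interval) :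
    gaussianOperator σ φ =ᵐ[lebesgueInterval]
      fun x ↦ ∫ y, gaussianKernel σ x y * φ y ∂lebesgueInterval :=
  (gaussianIntegral_memLp σ φ).coeFn_toLp

theorem gaussianOperator_isSymmetric (σ : ℝ) : (gaussianOperator σ).IsSymmetric :=
  isSymmetric_of_ae_eq_integral_mul (K := gaussianKernel σ)
    (gaussianKernel_continuous σ).aestronglyMeasurable
    (gaussianKernel_norm_le_one σ) (gaussianKernel_comm σ) (coeFn_gaussianOperator σ)

theorem exists_mem_polynomialsLT_norm_sub_le (σ x : ℝ) (n : ℕ) :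
    ∃ p ∈ polynomialsLT n, ‖continuousToL2Interval (gaussianSection σ x) - p‖ ≤
      √2 * (2 * |σ| ^ n / (2 ^ n * Gamma ((n : ℝ) / 2 + 1))) := by
  have hsmooth : ContDiff ℝ n (gaussianKernel σ x) := by
    unfold gaussianKernel
    fun_prop
  obtain ⟨p, hp, hpM⟩ := exists_mem_degreeLT_abs_sub_eval_le hsmooth
    fun ξ _ ↦ abs_iteratedDeriv_gaussianKernel_le σ x n ξ
  refine ⟨_, Submodule.mem_map_of_mem hp, ?_⟩
  rw [LinearMap.comp_apply, ← map_sub]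
  refine norm_continuousToL2Interval_le fun y hy ↦ (hpM y hy).trans_eq ?_
  field_simp

theorem orderedEigenvalue_gaussianOperator_succ_le (σ : ℝ) (n : ℕ) :
    orderedEigenvalue (gaussianOperator σ) (n + 1) ≤
      4 * |σ| ^ n / (2 ^ n * Gamma ((n : ℝ) / 2 + 1)) := by
  refine (orderedEigenvalue_le_of_ae_exists_mem_norm_sub_le (gaussianOperator_isSymmetric σ)
    (κ := fun x ↦ continuousToL2Interval (gaussianSection σ x)) (fun φ ↦ ?_)
    (Nat.lt_succ_of_le (finrank_polynomialsLT_le n)) (by positivity)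
    (.of_forall fun x ↦ exists_mem_polynomialsLT_norm_sub_le σ x n)).trans_eq ?_
  · simp_rw [inner_continuousToL2Interval]
    exact coeFn_gaussianOperator σ φ
  · rw [measureReal_lebesgueInterval_univ, ← mul_assoc, mul_self_sqrt two_pos.le]
    ring

end GaussianOperator

section GammaBound

open Real Set

theorem rpow_mul_exp_neg_le_Gamma_add_one {m : ℝ} (hm : 0 ≤ m) :
    m ^ m * exp (-m) ≤ Gamma (m + 1) := by
  have hint : IntegrableOn (fun x ↦ exp (-x) * x ^ m) (Ioi 0) := by
    simpa using GammaIntegral_convergent (s := m + 1) (by linarith)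
  calc m ^ m * exp (-m) = ∫ x in Ioi m, exp (-x) * m ^ m := by
        rw [integral_mul_const, integral_exp_neg_Ioi, mul_comm]
    _ ≤ ∫ x in Ioi m, exp (-x) * x ^ m := by
        refine setIntegral_mono_on ((integrableOn_exp_neg_Ioi m).mul_const _)
          (hint.mono_set (Ioi_subset_Ioi hm)) measurableSet_Ioi fun x hx ↦ ?_
        gcongr
        exact hx.le
    _ ≤ ∫ x in Ioi 0, exp (-x) * x ^ m := by
        refine setIntegral_mono_set hint ?_ (Ioi_subset_Ioi hm).eventuallyLE
        filter_upwards [ae_restrict_mem measurableSet_Ioi] with x (hx : 0 < x)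
        exact mul_nonneg (exp_pos _).le (rpow_nonneg hx.le _)
    _ = Gamma (m + 1) := by rw [Gamma_eq_integral (by linarith), add_sub_cancel_right]

theorem inv_two_rpow_mul_Gamma_le {x : ℝ} (hx : 0 ≤ x) :
    (2 ^ x * Gamma (x / 2 + 1))⁻¹ ≤ (2 / exp 1 * x) ^ (-x / 2) := by
  have hbase : 2 / exp 1 * x = 2 ^ (2 : ℝ) * (x / 2 * exp (-1)) := by
    rw [exp_neg, rpow_two]
    field_simp
  have hpow : (2 / exp 1 * x) ^ (x / 2) = 2 ^ x * ((x / 2) ^ (x / 2) * exp (-(x / 2))) := by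
    rw [hbase, mul_rpow (by positivity) (by positivity), ← rpow_mul two_pos.le,
      mul_div_cancel₀ _ two_ne_zero, mul_rpow (by positivity) (exp_pos _).le, ← exp_mul,
      neg_one_mul]
  have hpos : 0 < (x / 2) ^ (x / 2) := by
    rcases hx.eq_or_lt with rfl | hx
    · simp
    · positivity
  rw [neg_div, rpow_neg (by positivity), hpow]
  gcongr
  exact rpow_mul_exp_neg_le_Gamma_add_one (by positivity)

end GammaBound

theorem mainTheorem7 (σ : ℝ) (hσ : 0 < σ) (k : ℕ) (hk : 1 ≤ k) :
    orderedEigenvalue (gaussianOperator σ) k <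
      8 * (2 / Real.exp 1 * ((k : ℝ) - 1)) ^ (-((k : ℝ) - 1) / 2) * σ ^ (k - 1) := by
  obtain ⟨n, rfl⟩ : ∃ n, k = n + 1 := ⟨k - 1, by omega⟩
  simp only [Nat.cast_add, Nat.cast_one, add_sub_cancel_right, Nat.add_sub_cancel]
  calc orderedEigenvalue (gaussianOperator σ) (n + 1)
      ≤ 4 * |σ| ^ n / (2 ^ n * Real.Gamma ((n : ℝ) / 2 + 1)) :=
        orderedEigenvalue_gaussianOperator_succ_le σ n
    _ = 4 * ((2 ^ (n : ℝ) * Real.Gamma ((n : ℝ) / 2 + 1))⁻¹ * σ ^ n) := by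
        rw [abs_of_pos hσ, Real.rpow_natCast]
        ring
    _ < 8 * ((2 ^ (n : ℝ) * Real.Gamma ((n : ℝ) / 2 + 1))⁻¹ * σ ^ n) := by
        gcongr
        norm_num
    _ ≤ 8 * ((2 / Real.exp 1 * n) ^ (-(n : ℝ) / 2) * σ ^ n) := by
        gcongr
        exact inv_two_rpow_mul_Gamma_le n.cast_nonneg
    _ = 8 * (2 / Real.exp 1 * n) ^ (-(n : ℝ) / 2) * σ ^ n := by ring
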